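/- Let $n\in\mathbb N$, let $\Omega\subset\mathbb R^n$ be open, and write $\langle\xi\rangle=\sqrt{1+|\xi|^2}$. **Weights.** Let $\Lambda=(\lambda_1,\dots,\lambda_n)$ be a weight vector: the $\lambda_j:\mathbb R^n\to(0,\infty)$ are continuous and there are constants $C,c>0$ such that, for all $j$ and all $\xi,\eta\in\mathbb R^n$, $c\langle\xi\rangle^{c}\le\lambda_j(\xi)\le C\langle\xi\rangle^{C}$, $\lambda_j(\xi)\ge c|\xi_j|$, and $$\sum_{k=1}^n|\xi_k-\eta_k|\,\lambda_k(\eta)^{-1}\le c\ \Longrightarrow\ c\,\lambda_j(\xi)\le\lambda_j(\eta)\le C\lambda_j(\xi).$$ Let $m:\mathbb R^n\to(0,\infty)$ be an admissible weight associated to $\Lambda$: $m$ is continuous and, for some $N,C,c>0$ and all $\xi,\eta$, $m(\eta)\le C\,m(\xi)(1+|\eta-\xi|)^N$, and $\sum_k|\xi_k-\eta_k|\lambda_k(\eta)^{-1}\le c$ implies $c\,m(\xi)\le m(\eta)\le C\,m(\xi)$. Assume that $m$ is bounded below by a positive constant on $\mathbb R^n$. **Symbols and operators.** Let $a\in S_{m,\Lambda}(\Omega)$,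 that is, $a\in C^\infty(\Omega\times\mathbb R^n)$ is complex valued and, for every compact $K\subset\Omega$ and all multi-indices $\alpha,\beta$, there is $c_{\alpha,\beta,K}>0$ with $$\sup_{x\in K}|\partial_\xi^\alpha\partial_x^\beta a(x,\xi)|\le c_{\alpha,\beta,K}\,m(\xi)\prod_{k=1}^n\lambda_k(\xi)^{-\alpha_k},\qquad \xi\in\mathbb R^n.$$ For $u\in C_0^\infty(\Omega)$ let $$a(x,D)u(x)=(2\pi)^{-n}\int_{\mathbb R^n} e^{ix\cdot\xi}a(x,\xi)\hat u(\xi)\,d\xi,\qquad \hat u(\xi)=\int_{\mathbb R^n} e^{-iy\cdot\xi}u(y)\,dy .$$ Assume that $a(x,D)$ is properly supported: both projections to $\Omega$ from the support in $\Omega\times\Omega$ of its Schwartz kernel are proper maps. **Conclusion.** For every $1<p<\infty$, the operator $T_a:u\mapsto a(x,D)u$ with domain $C_0^\infty(\Omega)$, considered as a linear operator from $L^p_{\rm loc}(\Omega)$ to itself, is closable: the closure of its graph in $L^p_{\rm loc}(\Omega)\times L^p_{\rm loc}(\Omega)$ is the graph of a linear operator. Here $L^p_{\rm loc}(\Omega)$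 is the Fréchet space with the seminorms $\|f\|_{L^p(K)}$, $K\subset\Omega$ compact. -/

import Mathlib

open MeasureTheory TopologicalSpace
open scoped ENNReal ContDiff Distributions RealInnerProductSpace

noncomputable section

namespace MPseudo

/-- The Euclidean space `ℝⁿ`. -/
abbrev Rn (n : ℕ) : Type := EuclideanSpace ℝ (Fin n)

variable {n : ℕ}

/-! ### Weight vectors, admissible weights, symbols -/

/-- `⟨ξ⟩ = √(1 + |ξ|²)`. -/
def bracket (ξ : Rn n) : ℝ := √(1 + ‖ξ‖ ^ 2)

/-- A weight vector `Λ = (λ₁, …, λₙ)`: positive continuous components with polynomial growth,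
the M-condition `λⱼ(ξ) ≥ c |ξⱼ|`, and the slowly varying condition. -/
structure IsWeightVector (Λ : Fin n → Rn n → ℝ) : Prop where
  continuous : ∀ j, Continuous (Λ j)
  pos : ∀ j ξ, 0 < Λ j ξ
  bounds : ∃ C c : ℝ, 0 < C ∧ 0 < c ∧ ∀ j,
    (∀ ξ, c * bracket ξ ^ c ≤ Λ j ξ ∧ Λ j ξ ≤ C * bracket ξ ^ C) ∧
    (∀ ξ, c * |ξ j| ≤ Λ j ξ) ∧
    (∀ ξ η, ∑ k, |ξ k - η k| * (Λ k η)⁻¹ ≤ c →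
      c * Λ j ξ ≤ Λ j η ∧ Λ j η ≤ C * Λ j ξ)

/-- An admissible weight associated to `Λ`: a positive continuous function which is temperate and
slowly varying with respect to `Λ`. -/
structure IsAdmissibleWeight (Λ : Fin n → Rn n → ℝ) (m : Rn n → ℝ) : Prop where
  continuous : Continuous m
  pos : ∀ ξ, 0 < m ξ
  temperate : ∃ N C : ℝ, 0 < N ∧ 0 < C ∧ ∀ ξ η, m η ≤ C * m ξ * (1 + ‖η - ξ‖) ^ N
  slowlyVarying : ∃ C c : ℝ, 0 < C ∧ 0 < c ∧ ∀ ξ η,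
    ∑ k, |ξ k - η k| * (Λ k η)⁻¹ ≤ c → c * m ξ ≤ m η ∧ m η ≤ C * m ξ

/-- `∂/∂xⱼ` of a function of `(x, ξ)`. -/
def partialX (j : Fin n) (f : Rn n × Rn n → ℂ) : Rn n × Rn n → ℂ :=
  fun z => fderiv ℝ f z (EuclideanSpace.single j 1, 0)

/-- `∂/∂ξⱼ` of a function of `(x, ξ)`. -/
def partialXi (j : Fin n) (f : Rn n × Rn n → ℂ) : Rn n × Rn n → ℂ :=
  fun z => fderiv ℝ f z (0, EuclideanSpace.single j 1)

/-- For first order operators `D₁, …, Dₙ` and a multi-index `α`,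
the operator `D^α = D₁^α₁ ⋯ Dₙ^αₙ`. -/
def multiPow (D : Fin n → (Rn n × Rn n → ℂ) → (Rn n × Rn n → ℂ)) (α : Fin n → ℕ)
    (f : Rn n × Rn n → ℂ) : Rn n × Rn n → ℂ :=
  (List.finRange n).foldr (fun j g => (D j)^[α j] g) f

/-- The symbol class `S_{m,Λ}(Ω)`. A symbol is represented by a function on `ℝⁿ × ℝⁿ`, of which
only the restriction to `Ω × ℝⁿ` matters. -/
structure IsSymbol (Λ : Fin n → Rn n → ℝ) (m : Rn n → ℝ) (Ω : Opens (Rn n))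
    (a : Rn n × Rn n → ℂ) : Prop where
  smooth : ContDiffOn ℝ ∞ a ((Ω : Set (Rn n)) ×ˢ Set.univ)
  estimate : ∀ K : Set (Rn n), IsCompact K → K ⊆ Ω → ∀ α β : Fin n → ℕ,
    ∃ C : ℝ, 0 < C ∧ ∀ x ∈ K, ∀ ξ,
      ‖multiPow partialXi α (multiPow partialX β a) (x, ξ)‖ ≤
        C * m ξ * (∏ k, Λ k ξ ^ α k)⁻¹

/-! ### The operator `a(x, D)` and its distribution kernel -/

/-- The Fourier transform `û(ξ) = ∫ e^{-i y·ξ} u(y) dy`. -/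
def fourierHat (u : Rn n → ℂ) (ξ : Rn n) : ℂ :=
  ∫ y, Complex.exp (-(Complex.I * (⟪y, ξ⟫ : ℝ))) * u y

/-- `a(x, D)u(x) = (2π)⁻ⁿ ∫ e^{i x·ξ} a(x, ξ) û(ξ) dξ`. -/
def pdo (a : Rn n × Rn n → ℂ) (u : Rn n → ℂ) (x : Rn n) : ℂ :=
  ((2 * Real.pi : ℝ) ^ n : ℂ)⁻¹ *
    ∫ ξ, Complex.exp (Complex.I * (⟪x, ξ⟫ : ℝ)) * a (x, ξ) * fourierHat u ξ

/-- The open set `Ω × Ω`. -/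
def square (Ω : Opens (Rn n)) : Opens (Rn n × Rn n) :=
  ⟨(Ω : Set (Rn n)) ×ˢ (Ω : Set (Rn n)), Ω.isOpen.prod Ω.isOpen⟩

/-- The Schwartz kernel of `a(x, D)` as a functional on `C₀^∞(Ω × Ω)`, i.e. the distribution
`(2π)⁻ⁿ ∫ e^{i (x - y)·ξ} a(x, ξ) dξ` understood as an oscillatory integral:
`Φ ↦ ∫_Ω a(x, D)[Φ(x, ·)](x) dx`. On `Φ(x, y) = ψ(x) φ(y)` it takes the
value `∫_Ω ψ(x) (a(x, D)φ)(x) dx`. -/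
def kernel (Ω : Opens (Rn n)) (a : Rn n × Rn n → ℂ) (Φ : 𝓓(square Ω, ℂ)) : ℂ :=
  ∫ x in (Ω : Set (Rn n)), pdo a (fun y => Φ (x, y)) x

/-- The support, a relatively closed subset of `Ω × Ω`, of the Schwartz kernel of `a(x, D)`. -/
def kernelSupport (Ω : Opens (Rn n)) (a : Rn n × Rn n → ℂ) : Set (Rn n × Rn n) :=
  Distribution.dsupport (kernel Ω a) ∩ (Ω : Set (Rn n)) ×ˢ (Ω : Set (Rn n))

/-- `a(x, D)` is properly supported in `Ω`: both projections from the support of its Schwartz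
kernel to `Ω` are proper, i.e. preimages of compact subsets of `Ω` are compact. -/
def IsProperlySupported (Ω : Opens (Rn n)) (a : Rn n × Rn n → ℂ) : Prop :=
  ∀ K : Set (Rn n), IsCompact K → K ⊆ Ω →
    IsCompact (kernelSupport Ω a ∩ Prod.fst ⁻¹' K) ∧
    IsCompact (kernelSupport Ω a ∩ Prod.snd ⁻¹' K)

/-! ### The Fréchet space `L^p_loc(Ω)` -/

/-- `L^p_loc(Ω)` as a subspace of the space of (classes of) measurable functions on `Ω`. -/
def lpLocSubmodule (Ω : Opens (Rn n)) (p : ℝ≥0∞) :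
    Submodule ℂ (Rn n →ₘ[volume.restrict (Ω : Set (Rn n))] ℂ) where
  carrier := {f | ∀ K : Set (Rn n), IsCompact K → K ⊆ Ω → MemLp f p (volume.restrict K)}
  zero_mem' K _ hKΩ := by
    have h : ((0 : Rn n →ₘ[volume.restrict (Ω : Set (Rn n))] ℂ) : Rn n → ℂ)
        =ᵐ[volume.restrict K] 0 :=
      ae_mono (Measure.restrict_mono hKΩ le_rfl) AEEqFun.coeFn_zero
    exact (memLp_congr_ae h).2 MemLp.zero
  add_mem' {f g} hf hg K hK hKΩ := by
    have h : ((f + g : Rn n →ₘ[volume.restrict (Ω : Set (Rn n))] ℂ) : Rn n → ℂ)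
        =ᵐ[volume.restrict K] f + g :=
      ae_mono (Measure.restrict_mono hKΩ le_rfl) (AEEqFun.coeFn_add f g)
    exact (memLp_congr_ae h).2 ((hf K hK hKΩ).add (hg K hK hKΩ))
  smul_mem' c f hf K hK hKΩ := by
    have h : ((c • f : Rn n →ₘ[volume.restrict (Ω : Set (Rn n))] ℂ) : Rn n → ℂ)
        =ᵐ[volume.restrict K] c • (f : Rn n → ℂ) :=
      ae_mono (Measure.restrict_mono hKΩ le_rfl) (AEEqFun.coeFn_smul c f)
    exact (memLp_congr_ae h).2 ((hf K hK hKΩ).const_smul c)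

/-- The space `L^p_loc(Ω)`. -/
def LpLoc (Ω : Opens (Rn n)) (p : ℝ≥0∞) : Type := lpLocSubmodule Ω p

instance (Ω : Opens (Rn n)) (p : ℝ≥0∞) : AddCommGroup (LpLoc Ω p) :=
  inferInstanceAs (AddCommGroup (lpLocSubmodule Ω p))

instance (Ω : Opens (Rn n)) (p : ℝ≥0∞) : Module ℂ (LpLoc Ω p) :=
  inferInstanceAs (Module ℂ (lpLocSubmodule Ω p))

/-- The compact subsets of `Ω`. -/
abbrev CompactsIn (Ω : Opens (Rn n)) : Type := {K : Compacts (Rn n) // (K : Set (Rn n)) ⊆ Ω}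

instance (Ω : Opens (Rn n)) : Nonempty (CompactsIn Ω) :=
  ⟨⟨⊥, by simp⟩⟩

/-- The seminorms `f ↦ ‖f‖_{L^p(K)}` of `L^p_loc(Ω)`, for `K` a compact subset of `Ω`. -/
def LpLoc.seminorms (Ω : Opens (Rn n)) (p : ℝ≥0∞) [Fact (1 ≤ p)] :
    SeminormFamily ℂ (LpLoc Ω p) (CompactsIn Ω) := fun K =>
  Seminorm.of
    (fun f => (eLpNorm (f.1 : Rn n → ℂ) p (volume.restrict (K.1 : Set (Rn n)))).toReal)
    (fun f g => by
      have hf := f.2 K.1 K.1.isCompact K.2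
      have hg := g.2 K.1 K.1.isCompact K.2
      have h : ((f + g).1 : Rn n → ℂ) =ᵐ[volume.restrict (K.1 : Set (Rn n))] f.1 + g.1 :=
        ae_mono (Measure.restrict_mono K.2 le_rfl) (AEEqFun.coeFn_add f.1 g.1)
      rw [eLpNorm_congr_ae h, ← ENNReal.toReal_add hf.2.ne hg.2.ne]
      exact ENNReal.toReal_mono (ENNReal.add_ne_top.2 ⟨hf.2.ne, hg.2.ne⟩)
        (eLpNorm_add_le hf.1 hg.1 Fact.out))
    (fun c f => by
      have h : ((c • f).1 : Rn n → ℂ) =ᵐ[volume.restrict (K.1 : Set (Rn n))]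
          c • (f.1 : Rn n → ℂ) :=
        ae_mono (Measure.restrict_mono K.2 le_rfl) (AEEqFun.coeFn_smul c f.1)
      rw [eLpNorm_congr_ae h, eLpNorm_const_smul, ENNReal.toReal_mul]
      simp)

/-- The Fréchet topology of `L^p_loc(Ω)`, defined by the seminorms `‖f‖_{L^p(K)}`. -/
instance (Ω : Opens (Rn n)) (p : ℝ≥0∞) [Fact (1 ≤ p)] : TopologicalSpace (LpLoc Ω p) :=
  (LpLoc.seminorms Ω p).moduleFilterBasis.topology

theorem LpLoc.withSeminorms (Ω : Opens (Rn n)) (p : ℝ≥0∞) [Fact (1 ≤ p)] :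
    WithSeminorms (LpLoc.seminorms Ω p) := ⟨rfl⟩

instance (Ω : Opens (Rn n)) (p : ℝ≥0∞) [Fact (1 ≤ p)] : IsTopologicalAddGroup (LpLoc Ω p) :=
  (LpLoc.withSeminorms Ω p).topologicalAddGroup

instance (Ω : Opens (Rn n)) (p : ℝ≥0∞) [Fact (1 ≤ p)] : ContinuousSMul ℂ (LpLoc Ω p) :=
  (LpLoc.withSeminorms Ω p).continuousSMul

/-- The class in `L^p_loc(Ω)` of a function which is continuous on `Ω`. -/
def LpLoc.ofContinuousOn {Ω : Opens (Rn n)} (p : ℝ≥0∞) (f : Rn n → ℂ)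
    (hf : ContinuousOn f Ω) : LpLoc Ω p :=
  ⟨AEEqFun.mk f (hf.aestronglyMeasurable Ω.isOpen.measurableSet), fun K hK hKΩ => by
    have h := ae_mono (Measure.restrict_mono hKΩ le_rfl)
      (AEEqFun.coeFn_mk f (hf.aestronglyMeasurable (μ := volume) Ω.isOpen.measurableSet))
    refine (memLp_congr_ae h).2 ?_
    obtain ⟨B, hB⟩ := hK.exists_bound_of_continuousOn (hf.mono hKΩ)
    have : IsFiniteMeasure (volume.restrict K) := ⟨by simpa using hK.measure_lt_top⟩
    exact MemLp.of_bound ((hf.mono hKΩ).aestronglyMeasurable hK.measurableSet) B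
      ((ae_restrict_iff' hK.measurableSet).2 (Filter.Eventually.of_forall hB))⟩

/-! ### The operator `T_a` in `L^p_loc(Ω)` with domain `C₀^∞(Ω)` -/

theorem fourierHat_eq (u : Rn n → ℂ) (ξ : Rn n) :
    fourierHat u ξ = FourierTransform.fourier u ((2 * Real.pi)⁻¹ • ξ) := by
  rw [Real.fourier_eq', fourierHat]
  congr 1
  ext y
  rw [smul_eq_mul, inner_smul_right]
  congr 2
  have : (Real.pi : ℂ) ≠ 0 := by exact_mod_cast Real.pi_ne_zero
  push_cast
  field_simp

/-- The Fourier transform of a test function, as a Schwartz function. -/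
theorem exists_schwartz_fourierHat {Ω : Opens (Rn n)} (φ : 𝓓(Ω, ℂ)) :
    ∃ g : SchwartzMap (Rn n) ℂ, ∀ ξ, fourierHat φ ξ = g ξ := by
  have hpi : (2 * Real.pi)⁻¹ ≠ 0 := by positivity
  refine ⟨SchwartzMap.compCLMOfContinuousLinearEquiv ℂ
    (ContinuousLinearEquiv.smulLeft (R₁ := ℝ) (M₁ := Rn n) (Units.mk0 _ hpi))
    (FourierTransform.fourier (φ.hasCompactSupport.toSchwartzMap φ.contDiff)), fun ξ => ?_⟩
  rw [fourierHat_eq]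
  rfl

variable {Λ : Fin n → Rn n → ℝ} {m : Rn n → ℝ} {Ω : Opens (Rn n)} {a : Rn n × Rn n → ℂ}

theorem IsSymbol.continuousOn (ha : IsSymbol Λ m Ω a) :
    ContinuousOn a ((Ω : Set (Rn n)) ×ˢ Set.univ) := ha.smooth.continuousOn

theorem multiPow_zero (D : Fin n → (Rn n × Rn n → ℂ) → (Rn n × Rn n → ℂ))
    (f : Rn n × Rn n → ℂ) : multiPow D 0 f = f := by
  simp [multiPow]

/-- Symbols grow at most polynomially, locally uniformly in `x`. -/
theorem IsSymbol.exists_bound (hm : IsAdmissibleWeight Λ m) (ha : IsSymbol Λ m Ω a)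
    {K : Set (Rn n)} (hK : IsCompact K) (hKΩ : K ⊆ Ω) :
    ∃ (C : ℝ) (N : ℕ), ∀ x ∈ K, ∀ ξ, ‖a (x, ξ)‖ ≤ C * (1 + ‖ξ‖) ^ N := by
  obtain ⟨C, hC, h⟩ := ha.estimate K hK hKΩ 0 0
  obtain ⟨N, C', -, hC', h'⟩ := hm.temperate
  refine ⟨C * (C' * m 0), ⌈N⌉₊, fun x hx ξ => ?_⟩
  have h1 := h x hx ξ
  simp only [multiPow_zero, Pi.zero_apply, pow_zero, Finset.prod_const_one, inv_one,
    mul_one] at h1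
  have h2 := h' 0 ξ
  rw [sub_zero] at h2
  have h3 : (1 + ‖ξ‖) ^ N ≤ (1 + ‖ξ‖) ^ ⌈N⌉₊ := by
    rw [← Real.rpow_natCast]
    exact Real.rpow_le_rpow_of_exponent_le (by linarith [norm_nonneg ξ]) (Nat.le_ceil N)
  have h4 : 0 ≤ C' * m 0 := (mul_pos hC' (hm.pos 0)).le
  calc ‖a (x, ξ)‖ ≤ C * m ξ := h1
    _ ≤ C * (C' * m 0 * (1 + ‖ξ‖) ^ N) := by gcongr
    _ ≤ C * (C' * m 0 * (1 + ‖ξ‖) ^ ⌈N⌉₊) := by gcongr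
    _ = _ := by ring

theorem schwartz_integrable (g : SchwartzMap (Rn n) ℂ) (C : ℝ) (N : ℕ) :
    Integrable (fun ξ : Rn n => C * (1 + ‖ξ‖) ^ N * ‖g ξ‖) := by
  have h : ∀ k : ℕ, Integrable (fun ξ : Rn n => ‖ξ‖ ^ k * ‖g ξ‖) :=
    fun k => g.integrable_pow_mul volume k
  have h2 : Integrable (fun ξ : Rn n => ∑ k ∈ Finset.range (N + 1),
      C * (N.choose k : ℝ) * (‖ξ‖ ^ k * ‖g ξ‖)) :=
    integrable_finsetSum _ fun k _ => (h k).const_mul _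
  refine h2.congr (Filter.Eventually.of_forall fun ξ => ?_)
  simp only
  rw [add_comm (1 : ℝ), add_pow, Finset.mul_sum, Finset.sum_mul]
  refine Finset.sum_congr rfl fun k _ => ?_
  ring

theorem integrand_measurable (ha : IsSymbol Λ m Ω a) (φ : 𝓓(Ω, ℂ)) {x : Rn n} (hx : x ∈ Ω) :
    Continuous fun ξ =>
      Complex.exp (Complex.I * (⟪x, ξ⟫ : ℝ)) * a (x, ξ) * fourierHat φ ξ := by
  obtain ⟨g, hg⟩ := exists_schwartz_fourierHat φ
  simp only [hg]
  have h1 : Continuous fun ξ => a (x, ξ) :=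
    ha.continuousOn.comp_continuous (by fun_prop) fun ξ => ⟨hx, Set.mem_univ _⟩
  have h2 : Continuous fun ξ : Rn n => Complex.exp (Complex.I * (⟪x, ξ⟫ : ℝ)) := by fun_prop
  exact (h2.mul h1).mul g.continuous

theorem integrand_bound {K : Set (Rn n)} {C : ℝ} {N : ℕ}
    (h : ∀ x ∈ K, ∀ ξ, ‖a (x, ξ)‖ ≤ C * (1 + ‖ξ‖) ^ N) (u : Rn n → ℂ) {x : Rn n} (hx : x ∈ K)
    (ξ : Rn n) : ‖Complex.exp (Complex.I * (⟪x, ξ⟫ : ℝ)) * a (x, ξ) * fourierHat u ξ‖ ≤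
      C * (1 + ‖ξ‖) ^ N * ‖fourierHat u ξ‖ := by
  rw [norm_mul, norm_mul, mul_comm Complex.I, Complex.norm_exp_ofReal_mul_I, one_mul]
  gcongr
  exact h x hx ξ

theorem integrand_integrable (hm : IsAdmissibleWeight Λ m) (ha : IsSymbol Λ m Ω a) (φ : 𝓓(Ω, ℂ))
    {x : Rn n} (hx : x ∈ Ω) :
    Integrable fun ξ =>
      Complex.exp (Complex.I * (⟪x, ξ⟫ : ℝ)) * a (x, ξ) * fourierHat φ ξ := by
  obtain ⟨C, N, h⟩ := ha.exists_bound hm (isCompact_singleton (x := x)) (by simpa using hx)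
  obtain ⟨g, hg⟩ := exists_schwartz_fourierHat φ
  refine (schwartz_integrable g C N).mono' (integrand_measurable ha φ hx).aestronglyMeasurable
    (Filter.Eventually.of_forall fun ξ => ?_)
  rw [← hg]
  exact integrand_bound h φ (Set.mem_singleton x) ξ

/-- `a(x, D)φ` is continuous on `Ω`. -/
theorem pdo_continuousOn (hm : IsAdmissibleWeight Λ m) (ha : IsSymbol Λ m Ω a) (φ : 𝓓(Ω, ℂ)) :
    ContinuousOn (pdo a φ) Ω := by
  intro x₀ hx₀
  obtain ⟨K, hK, hx₀K, hKΩ⟩ := exists_compact_subset Ω.isOpen hx₀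
  obtain ⟨C, N, h⟩ := ha.exists_bound hm hK hKΩ
  obtain ⟨g, hg⟩ := exists_schwartz_fourierHat φ
  refine ContinuousAt.continuousWithinAt ?_
  refine ContinuousAt.mul continuousAt_const ?_
  have hev : ∀ᶠ x in nhds x₀, x ∈ K := mem_interior_iff_mem_nhds.1 hx₀K
  refine continuousAt_of_dominated (bound := fun ξ => C * (1 + ‖ξ‖) ^ N * ‖g ξ‖)
    (hev.mono fun x hx => (integrand_measurable ha φ (hKΩ hx)).aestronglyMeasurable)
    (hev.mono fun x hx => Filter.Eventually.of_forall fun ξ => ?_)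
    (schwartz_integrable g C N) (Filter.Eventually.of_forall fun ξ => ?_)
  · rw [← hg]
    exact integrand_bound h φ hx ξ
  · have h1 : ContinuousAt (fun x => a (x, ξ)) x₀ :=
      ContinuousAt.comp (f := fun x => (x, ξ)) (g := a)
        (ha.continuousOn.continuousAt ((Ω.isOpen.prod isOpen_univ).mem_nhds ⟨hx₀, trivial⟩))
        (by fun_prop)
    have h2 : Continuous fun x : Rn n => Complex.exp (Complex.I * (⟪x, ξ⟫ : ℝ)) := by fun_prop
    exact (h2.continuousAt.mul h1).mul continuousAt_const

theorem fourierHat_add (φ ψ : 𝓓(Ω, ℂ)) (ξ : Rn n) :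
    fourierHat (φ + ψ : 𝓓(Ω, ℂ)) ξ = fourierHat φ ξ + fourierHat ψ ξ := by
  have hi : ∀ χ : 𝓓(Ω, ℂ), Integrable fun y : Rn n =>
      Complex.exp (-(Complex.I * (⟪y, ξ⟫ : ℝ))) * χ y := fun χ =>
    Continuous.integrable_of_hasCompactSupport (by fun_prop) χ.hasCompactSupport.mul_left
  unfold fourierHat
  rw [← integral_add (hi φ) (hi ψ)]
  congr 1
  ext y
  exact mul_add _ _ _

theorem fourierHat_smul (c : ℂ) (φ : 𝓓(Ω, ℂ)) (ξ : Rn n) :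
    fourierHat (c • φ : 𝓓(Ω, ℂ)) ξ = c * fourierHat φ ξ := by
  unfold fourierHat
  rw [← integral_const_mul]
  congr 1
  ext y
  exact mul_left_comm _ _ _

theorem pdo_add (hm : IsAdmissibleWeight Λ m) (ha : IsSymbol Λ m Ω a) (φ ψ : 𝓓(Ω, ℂ))
    {x : Rn n} (hx : x ∈ Ω) : pdo a (φ + ψ : 𝓓(Ω, ℂ)) x = pdo a φ x + pdo a ψ x := by
  unfold pdo
  rw [← mul_add, ← integral_add (integrand_integrable hm ha φ hx) (integrand_integrable hm ha ψ hx)]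
  simp only [fourierHat_add, mul_add]

theorem pdo_smul (c : ℂ) (φ : 𝓓(Ω, ℂ)) (x : Rn n) :
    pdo a (c • φ : 𝓓(Ω, ℂ)) x = c * pdo a φ x := by
  unfold pdo
  rw [mul_left_comm, ← integral_const_mul c]
  simp only [fourierHat_smul, mul_left_comm _ c]

theorem LpLoc.ext_ae {p : ℝ≥0∞} {f g : LpLoc Ω p}
    (h : (f.1 : Rn n → ℂ) =ᵐ[volume.restrict (Ω : Set (Rn n))] g.1) : f = g :=
  Subtype.ext (AEEqFun.ext h)

theorem LpLoc.coeFn_ofContinuousOn (p : ℝ≥0∞) (f : Rn n → ℂ) (hf : ContinuousOn f Ω) :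
    ((LpLoc.ofContinuousOn p f hf).1 : Rn n → ℂ) =ᵐ[volume.restrict (Ω : Set (Rn n))] f :=
  AEEqFun.coeFn_mk _ _

/-- The inclusion `C₀^∞(Ω) → L^p_loc(Ω)`. -/
def testInclusion (Ω : Opens (Rn n)) (p : ℝ≥0∞) : 𝓓(Ω, ℂ) →ₗ[ℂ] LpLoc Ω p where
  toFun φ := LpLoc.ofContinuousOn p φ φ.continuous.continuousOn
  map_add' φ ψ := LpLoc.ext_ae <| by
    refine (LpLoc.coeFn_ofContinuousOn p _ _).trans (.trans ?_ (AEEqFun.coeFn_add _ _).symm)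
    exact ((LpLoc.coeFn_ofContinuousOn p _ _).add (LpLoc.coeFn_ofContinuousOn p _ _)).symm
  map_smul' c φ := LpLoc.ext_ae <| by
    refine (LpLoc.coeFn_ofContinuousOn p _ _).trans (.trans ?_ (AEEqFun.coeFn_smul _ _).symm)
    exact ((LpLoc.coeFn_ofContinuousOn p _ _).const_smul c).symm

theorem testInclusion_injective (Ω : Opens (Rn n)) (p : ℝ≥0∞) :
    Function.Injective (testInclusion Ω p) := by
  intro φ ψ h
  have h1 : (φ : Rn n → ℂ) =ᵐ[volume.restrict (Ω : Set (Rn n))] ψ := by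
    refine (LpLoc.coeFn_ofContinuousOn p φ φ.continuous.continuousOn).symm.trans ?_
    refine .trans ?_ (LpLoc.coeFn_ofContinuousOn p ψ ψ.continuous.continuousOn)
    have h2 : (testInclusion Ω p φ).1 = (testInclusion Ω p ψ).1 := by rw [h]
    exact Filter.EventuallyEq.of_eq (congrArg (fun f : Rn n →ₘ[_] ℂ => (f : Rn n → ℂ)) h2)
  have h2 := Measure.eqOn_open_of_ae_eq h1 Ω.isOpen φ.continuous.continuousOn
    ψ.continuous.continuousOn
  ext x
  by_cases hx : x ∈ Ω
  · exact h2 hx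
  · rw [image_eq_zero_of_notMem_tsupport fun h => hx (φ.tsupport_subset h),
      image_eq_zero_of_notMem_tsupport fun h => hx (ψ.tsupport_subset h)]

/-- `φ ↦ a(x, D)φ` as a linear map `C₀^∞(Ω) → L^p_loc(Ω)`. -/
def pdoTest (p : ℝ≥0∞) (hm : IsAdmissibleWeight Λ m) (ha : IsSymbol Λ m Ω a) :
    𝓓(Ω, ℂ) →ₗ[ℂ] LpLoc Ω p where
  toFun φ := LpLoc.ofContinuousOn p (pdo a φ) (pdo_continuousOn hm ha φ)
  map_add' φ ψ := LpLoc.ext_ae <| by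
    refine (LpLoc.coeFn_ofContinuousOn p _ _).trans (.trans ?_ (AEEqFun.coeFn_add _ _).symm)
    refine .trans ?_
      ((LpLoc.coeFn_ofContinuousOn p _ _).add (LpLoc.coeFn_ofContinuousOn p _ _)).symm
    exact (ae_restrict_iff' Ω.isOpen.measurableSet).2
      (Filter.Eventually.of_forall fun x hx => pdo_add hm ha φ ψ hx)
  map_smul' c φ := LpLoc.ext_ae <| by
    refine (LpLoc.coeFn_ofContinuousOn p _ _).trans (.trans ?_ (AEEqFun.coeFn_smul _ _).symm)
    refine .trans ?_ ((LpLoc.coeFn_ofContinuousOn p _ _).const_smul c).symm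
    exact Filter.Eventually.of_forall fun x => pdo_smul c φ x

/-- The operator `T_a` in `L^p_loc(Ω)`: its domain is `C₀^∞(Ω)` (as a subspace of `L^p_loc(Ω)`) and
`T_a φ = a(x, D)φ` for `φ ∈ C₀^∞(Ω)`. -/
def opLpLoc (p : ℝ≥0∞) (hm : IsAdmissibleWeight Λ m) (ha : IsSymbol Λ m Ω a) :
    LpLoc Ω p →ₗ.[ℂ] LpLoc Ω p where
  domain := LinearMap.range (testInclusion Ω p)
  toFun := pdoTest p hm ha ∘ₗ
    (LinearEquiv.ofInjective (testInclusion Ω p) (testInclusion_injective Ω p)).symm.toLinearMap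

end MPseudo

end

noncomputable section

namespace MPseudo

variable {n : ℕ} {Λ : Fin n → Rn n → ℝ} {m : Rn n → ℝ} {Ω : Opens (Rn n)}
  {a f : Rn n × Rn n → ℂ}

/-! ### Decay of the transposed symbol transform -/

/-! Closability is a duality argument and needs no `L^p` bound for `a(x, D)`. The closure of the
graph is a subspace, so it is a graph once it contains no pair `(0, g)` with `g ≠ 0`. For test
functions, `∫ ψ · a(x, D)φ = ∫ φ · w`, where `w = transposePdo a ψ` (`integral_mul_pdo_eq`). If both
sides are continuous for the `L^p_loc` topology, the identity passes to the closure; there `f = 0`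
forces `∫ ψ g = 0` for every `ψ`, hence `g = 0`.

Two facts make the right side continuous. The function `w` is continuous: integrating by parts in
`x` shows that `symbolTransform a ψ` is `m` times a rapidly decreasing factor, and temperateness of
`m` makes it integrable (`IsSymbol.integrable_symbolTransform`). Moreover `w` vanishes on `Ω` off
the second projection of the kernel support lying over `tsupport ψ` (`transposePdo_eq_zero`). That
projection is compact by proper support, so Hölder's inequality applies on it
(`LpLoc.continuous_setIntegralMul`). -/

theorem foldr_iterate_single {β : Type*} {ι : Type*} [DecidableEq ι] (D : ι → β → β) (j : ι)
    (l : ℕ) (b : β) (L : List ι) (hL : L.Nodup) :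
    L.foldr (fun i g => (D i)^[(Pi.single j l : ι → ℕ) i] g) b =
      if j ∈ L then (D j)^[l] b else b := by
  induction L with
  | nil => simp
  | cons i L ih =>
    obtain ⟨hi, hL⟩ := List.nodup_cons.1 hL
    rw [List.foldr_cons, ih hL]
    by_cases hij : j = i
    · subst hij
      simp [hi]
    · simp [hij, Ne.symm hij]

theorem multiPow_single (D : Fin n → (Rn n × Rn n → ℂ) → (Rn n × Rn n → ℂ)) (j : Fin n) (l : ℕ)
    (f : Rn n × Rn n → ℂ) : multiPow D (Pi.single j l) f = (D j)^[l] f := by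
  rw [multiPow, foldr_iterate_single D j l f _ (List.nodup_finRange n),
    if_pos (List.mem_finRange j)]

/-- Derivatives in `x` cost nothing in the symbol estimate: the bound is `m` itself, whatever the
order. This is what makes repeated integration by parts in `x` profitable. -/
theorem IsSymbol.bound_iterate_partialX (ha : IsSymbol Λ m Ω a) {K : Set (Rn n)}
    (hK : IsCompact K) (hKΩ : K ⊆ Ω) (j : Fin n) (l : ℕ) :
    ∃ C : ℝ, 0 < C ∧ ∀ x ∈ K, ∀ ξ, ‖(partialX j)^[l] a (x, ξ)‖ ≤ C * m ξ := by
  obtain ⟨C, hC, h⟩ := ha.estimate K hK hKΩ 0 (Pi.single j l)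
  refine ⟨C, hC, fun x hx ξ => ?_⟩
  simpa [multiPow_zero, multiPow_single] using h x hx ξ

theorem isOpen_cylinder (Ω : Opens (Rn n)) :
    IsOpen ((Ω : Set (Rn n)) ×ˢ (Set.univ : Set (Rn n))) := Ω.isOpen.prod isOpen_univ

theorem contDiffOn_partialX {f : Rn n × Rn n → ℂ}
    (hf : ContDiffOn ℝ ∞ f ((Ω : Set (Rn n)) ×ˢ Set.univ)) (j : Fin n) :
    ContDiffOn ℝ ∞ (partialX j f) ((Ω : Set (Rn n)) ×ˢ Set.univ) :=
  (hf.fderiv_of_isOpen (isOpen_cylinder Ω) (by simp)).clm_apply contDiffOn_const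

theorem contDiffOn_iterate_partialX {f : Rn n × Rn n → ℂ}
    (hf : ContDiffOn ℝ ∞ f ((Ω : Set (Rn n)) ×ˢ Set.univ)) (j : Fin n) (l : ℕ) :
    ContDiffOn ℝ ∞ ((partialX j)^[l] f) ((Ω : Set (Rn n)) ×ˢ Set.univ) := by
  induction l with
  | zero => exact hf
  | succ l ih =>
    rw [Function.iterate_succ_apply']
    exact contDiffOn_partialX ih j

/-- The partial derivative `∂ψ/∂xⱼ` of a test function. -/
def testPartial (j : Fin n) (ψ : 𝓓(Ω, ℂ)) : 𝓓(Ω, ℂ) where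
  toFun x := fderiv ℝ ψ x (EuclideanSpace.single j 1)
  contDiff' := (ψ.contDiff.fderiv_right (m := ∞) (by simp)).clm_apply contDiff_const
  hasCompactSupport' := ψ.hasCompactSupport.fderiv_apply ℝ _
  tsupport_subset' := (tsupport_fderiv_apply_subset ℝ _).trans ψ.tsupport_subset

theorem testPartial_apply (j : Fin n) (ψ : 𝓓(Ω, ℂ)) (x : Rn n) :
    testPartial j ψ x = fderiv ℝ ψ x (EuclideanSpace.single j 1) := rfl

/-- `f` is arbitrary off `Ω`, but the product is locally zero away from `tsupport ψ`, so the cutoff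
yields a globally continuous function. -/
theorem continuous_mul_test (hf : ContinuousOn f ((Ω : Set (Rn n)) ×ˢ Set.univ))
    (ψ : 𝓓(Ω, ℂ)) : Continuous fun z : Rn n × Rn n => f z * ψ z.1 := by
  rw [continuous_iff_continuousAt]
  intro z
  by_cases hz : z.1 ∈ tsupport ψ
  · exact (hf.continuousAt ((isOpen_cylinder Ω).mem_nhds ⟨ψ.tsupport_subset hz, trivial⟩)).mul
      (ψ.continuous.comp continuous_fst).continuousAt
  · have h : ∀ᶠ w : Rn n × Rn n in nhds z, 0 = f w * ψ w.1 := by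
      filter_upwards [continuous_fst.continuousAt.eventually
        ((isClosed_tsupport ψ).isOpen_compl.mem_nhds hz)] with w hw
      rw [image_eq_zero_of_notMem_tsupport hw, mul_zero]
    exact continuousAt_const.congr h

theorem continuous_exp_inner :
    Continuous fun z : Rn n × Rn n => Complex.exp (Complex.I * (⟪z.1, z.2⟫ : ℝ)) := by
  fun_prop

theorem norm_exp_inner (x ξ : Rn n) : ‖Complex.exp (Complex.I * (⟪x, ξ⟫ : ℝ))‖ = 1 := by
  rw [mul_comm, Complex.norm_exp_ofReal_mul_I]

/-- `ξ ↦ ∫ e^{i x·ξ} f(x, ξ) ψ(x) dx`. -/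
def symbolTransform (f : Rn n × Rn n → ℂ) (ψ : Rn n → ℂ) (ξ : Rn n) : ℂ :=
  ∫ x, Complex.exp (Complex.I * (⟪x, ξ⟫ : ℝ)) * (f (x, ξ) * ψ x)

theorem continuous_symbolTransform_integrand
    (hf : ContinuousOn f ((Ω : Set (Rn n)) ×ˢ Set.univ)) (ψ : 𝓓(Ω, ℂ)) :
    Continuous fun z : Rn n × Rn n =>
      Complex.exp (Complex.I * (⟪z.1, z.2⟫ : ℝ)) * (f z * ψ z.1) :=
  continuous_exp_inner.mul (continuous_mul_test hf ψ)

theorem integrable_symbolTransform_integrand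
    (hf : ContinuousOn f ((Ω : Set (Rn n)) ×ˢ Set.univ)) (ψ : 𝓓(Ω, ℂ)) (ξ : Rn n) :
    Integrable fun x => Complex.exp (Complex.I * (⟪x, ξ⟫ : ℝ)) * (f (x, ξ) * ψ x) := by
  have hc : Continuous fun x => Complex.exp (Complex.I * (⟪x, ξ⟫ : ℝ)) * (f (x, ξ) * ψ x) :=
    (continuous_symbolTransform_integrand hf ψ).comp (g := fun z : Rn n × Rn n =>
      Complex.exp (Complex.I * (⟪z.1, z.2⟫ : ℝ)) * (f z * ψ z.1)) (f := fun x => (x, ξ))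
      (by fun_prop)
  refine hc.integrable_of_hasCompactSupport (HasCompactSupport.mul_left ?_)
  exact HasCompactSupport.mul_left ψ.hasCompactSupport

theorem aestronglyMeasurable_symbolTransform
    (hf : ContinuousOn f ((Ω : Set (Rn n)) ×ˢ Set.univ)) (ψ : 𝓓(Ω, ℂ)) :
    AEStronglyMeasurable (symbolTransform f ψ) (volume : Measure (Rn n)) :=
  StronglyMeasurable.aestronglyMeasurable <|
    (continuous_symbolTransform_integrand hf ψ).stronglyMeasurable.integral_prod_left'

theorem hasFDerivAt_slice (hf : ContDiffOn ℝ ∞ f ((Ω : Set (Rn n)) ×ˢ Set.univ))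
    {x : Rn n} (hx : x ∈ Ω) (ξ : Rn n) :
    HasFDerivAt (fun x => f (x, ξ)) ((fderiv ℝ f (x, ξ)).comp (.inl ℝ _ _)) x := by
  have h : DifferentiableAt ℝ f (x, ξ) :=
    (hf.differentiableOn (by simp)).differentiableAt
      ((isOpen_cylinder Ω).mem_nhds ⟨hx, trivial⟩)
  exact h.hasFDerivAt.comp x (hasFDerivAt_prodMk_left x ξ)

/-- Off `tsupport ψ` both terms of the Leibniz formula vanish, so it holds at every `x`, even where
`f` is not differentiable. -/
theorem hasFDerivAt_slice_mul (hf : ContDiffOn ℝ ∞ f ((Ω : Set (Rn n)) ×ˢ Set.univ))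
    (ψ : 𝓓(Ω, ℂ)) (x ξ : Rn n) : ∃ F : Rn n →L[ℝ] ℂ,
      HasFDerivAt (fun x => f (x, ξ) * ψ x) F x ∧ ∀ j, F (EuclideanSpace.single j 1) =
        partialX j f (x, ξ) * ψ x + f (x, ξ) * testPartial j ψ x := by
  by_cases hx : x ∈ tsupport ψ
  · have h1 := hasFDerivAt_slice hf (ψ.tsupport_subset hx) ξ
    have h2 : HasFDerivAt ψ (fderiv ℝ ψ x) x :=
      (ψ.contDiff.differentiable (by simp) x).hasFDerivAt
    refine ⟨_, h1.mul h2, fun j => ?_⟩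
    simp [partialX, testPartial_apply]
    ring
  · have hev : (fun x => f (x, ξ) * ψ x) =ᶠ[nhds x] fun _ => 0 := by
      filter_upwards [(isClosed_tsupport ψ).isOpen_compl.mem_nhds hx] with w hw
      rw [image_eq_zero_of_notMem_tsupport hw, mul_zero]
    refine ⟨0, (hasFDerivAt_const (0 : ℂ) x).congr_of_eventuallyEq hev, fun j => ?_⟩
    have h1 : testPartial j ψ x = 0 :=
      image_eq_zero_of_notMem_tsupport fun h => hx (tsupport_fderiv_apply_subset ℝ _ h)
    rw [h1, image_eq_zero_of_notMem_tsupport hx]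
    simp

theorem hasFDerivAt_exp_inner (x ξ : Rn n) :
    HasFDerivAt (fun x : Rn n => Complex.exp (Complex.I * (⟪x, ξ⟫ : ℝ)))
      (Complex.exp (Complex.I * (⟪x, ξ⟫ : ℝ)) •
        (Complex.I • (Complex.ofRealCLM.comp ((innerSL ℝ ξ : Rn n →L[ℝ] ℝ))))) x := by
  have h : HasFDerivAt (fun x : Rn n => ((⟪x, ξ⟫ : ℝ) : ℂ))
      (Complex.ofRealCLM.comp (innerSL ℝ ξ : Rn n →L[ℝ] ℝ)) x := by
    have h0 := (Complex.ofRealCLM.comp (innerSL ℝ ξ : Rn n →L[ℝ] ℝ)).hasFDerivAt (x := x)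
    refine h0.congr_of_eventuallyEq (Filter.Eventually.of_forall fun y => ?_)
    simp [real_inner_comm]
  exact (h.const_mul Complex.I).cexp

/-- The factor `i ξⱼ` is produced by `∂/∂xⱼ` acting on the exponential. Integration by parts moves
this derivative to `f ψ`, without boundary terms since `ψ` has compact support. -/
theorem mul_symbolTransform (hf : ContDiffOn ℝ ∞ f ((Ω : Set (Rn n)) ×ˢ Set.univ))
    (ψ : 𝓓(Ω, ℂ)) (j : Fin n) (ξ : Rn n) :
    Complex.I * ξ j * symbolTransform f ψ ξ =
      -(symbolTransform (partialX j f) ψ ξ + symbolTransform f (testPartial j ψ) ξ) := by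
  have hi1 := integrable_symbolTransform_integrand (contDiffOn_partialX hf j).continuousOn ψ ξ
  have hi2 := integrable_symbolTransform_integrand hf.continuousOn (testPartial j ψ) ξ
  have hi0 := integrable_symbolTransform_integrand hf.continuousOn ψ ξ
  choose F hF hF' using fun x => hasFDerivAt_slice_mul hf ψ x ξ
  have hfd : ∀ x, fderiv ℝ (fun x => f (x, ξ) * ψ x) x (EuclideanSpace.single j 1) =
      partialX j f (x, ξ) * ψ x + f (x, ξ) * testPartial j ψ x := fun x => by
    rw [(hF x).fderiv, hF']
  have hed : ∀ x, fderiv ℝ (fun x : Rn n => Complex.exp (Complex.I * (⟪x, ξ⟫ : ℝ))) x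
      (EuclideanSpace.single j 1) = Complex.exp (Complex.I * (⟪x, ξ⟫ : ℝ)) *
        (Complex.I * ξ j) := fun x => by
    rw [(hasFDerivAt_exp_inner x ξ).fderiv]
    simp [EuclideanSpace.inner_single_right]
  have key := integral_mul_fderiv_eq_neg_fderiv_mul_of_integrable (μ := (volume : Measure (Rn n)))
    (f := fun x : Rn n => f (x, ξ) * ψ x)
    (g := fun x : Rn n => Complex.exp (Complex.I * (⟪x, ξ⟫ : ℝ)))
    (v := EuclideanSpace.single j 1) ?_ ?_ ?_ (fun x _ => (hF x).differentiableAt)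
    (fun x _ => (hasFDerivAt_exp_inner x ξ).differentiableAt)
  · simp only [hfd, hed] at key
    rw [symbolTransform, symbolTransform, symbolTransform, ← integral_add hi1 hi2,
      ← integral_const_mul]
    convert! key using 2
    · ext x; ring
    · congr 1; ext x; ring
  · refine (hi1.add hi2).congr (Filter.Eventually.of_forall fun x => ?_)
    simp only [hfd, Pi.add_apply]
    ring
  · refine (hi0.const_mul (Complex.I * ξ j)).congr (Filter.Eventually.of_forall fun x => ?_)
    simp only [hed]
    ring
  · refine hi0.congr (Filter.Eventually.of_forall fun x => ?_)
    simp only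
    ring

theorem norm_symbolTransform_le {C : ℝ} {ψ : 𝓓(Ω, ℂ)} {ξ : Rn n}
    (h : ∀ x ∈ tsupport ψ, ‖f (x, ξ)‖ ≤ C) :
    ‖symbolTransform f ψ ξ‖ ≤ C * ∫ x, ‖ψ x‖ := by
  rw [← integral_const_mul]
  refine norm_integral_le_of_norm_le
    ((ψ.continuous.integrable_of_hasCompactSupport ψ.hasCompactSupport).norm.const_mul C)
    (Filter.Eventually.of_forall fun x => ?_)
  rw [norm_mul, norm_exp_inner, one_mul, norm_mul]
  by_cases hx : x ∈ tsupport ψ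
  · gcongr
    exact h x hx
  · simp [image_eq_zero_of_notMem_tsupport hx]

theorem IsSymbol.pow_mul_norm_symbolTransform_le (ha : IsSymbol Λ m Ω a) (j : Fin n) (k l : ℕ)
    (ψ : 𝓓(Ω, ℂ)) : ∃ C : ℝ, ∀ ξ,
      |ξ j| ^ k * ‖symbolTransform ((partialX j)^[l] a) ψ ξ‖ ≤ C * m ξ := by
  -- Each factor `ξⱼ` is traded for a derivative that falls on the symbol (raising `l`) or on the
  -- test function (changing `ψ`), so both must vary in the induction.
  induction k generalizing l ψ with
  | zero =>
    obtain ⟨C, -, h⟩ := ha.bound_iterate_partialX ψ.hasCompactSupport ψ.tsupport_subset j l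
    refine ⟨C * ∫ x, ‖ψ x‖, fun ξ => ?_⟩
    have := norm_symbolTransform_le (f := (partialX j)^[l] a) (ψ := ψ) (ξ := ξ)
      fun x hx => h x hx ξ
    rw [pow_zero, one_mul]
    exact this.trans_eq (by ring)
  | succ k ih =>
    obtain ⟨C₁, h₁⟩ := ih (l + 1) ψ
    obtain ⟨C₂, h₂⟩ := ih l (testPartial j ψ)
    refine ⟨C₁ + C₂, fun ξ => ?_⟩
    have h := congrArg norm (mul_symbolTransform (contDiffOn_iterate_partialX ha.smooth j l) ψ j ξ)
    rw [norm_mul, norm_mul, Complex.norm_I, one_mul, Complex.norm_real, Real.norm_eq_abs,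
      norm_neg, ← Function.iterate_succ_apply' (partialX j)] at h
    calc |ξ j| ^ (k + 1) * ‖symbolTransform ((partialX j)^[l] a) ψ ξ‖
        = |ξ j| ^ k * (|ξ j| * ‖symbolTransform ((partialX j)^[l] a) ψ ξ‖) := by ring
      _ ≤ |ξ j| ^ k * (‖symbolTransform ((partialX j)^[l + 1] a) ψ ξ‖ +
            ‖symbolTransform ((partialX j)^[l] a) (testPartial j ψ) ξ‖) := by
          rw [h]
          gcongr
          exact norm_add_le _ _
      _ ≤ (C₁ + C₂) * m ξ := by
          rw [mul_add, add_mul]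
          exact add_le_add (h₁ ξ) (h₂ ξ)

theorem norm_pow_le_sum_abs_pow (k : ℕ) (ξ : Rn n) :
    ‖ξ‖ ^ (k + 1) ≤ (n : ℝ) ^ k * ∑ j, |ξ j| ^ (k + 1) := by
  have h1 : ‖ξ‖ ≤ ∑ j, |ξ j| := by
    rw [EuclideanSpace.norm_eq]
    refine Real.sqrt_le_iff.2 ⟨by positivity, ?_⟩
    simpa using Finset.sum_sq_le_sq_sum_of_nonneg (s := Finset.univ) (f := fun j => |ξ j|)
      fun j _ => abs_nonneg _
  refine (pow_le_pow_left₀ (norm_nonneg ξ) h1 _).trans ?_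
  rcases Nat.eq_zero_or_pos n with rfl | hn
  -- The power mean inequality below is divided by the cardinality `n`, so `n = 0` is treated apart.
  · simp
  have h2 := pow_sum_div_card_le_sum_pow (s := Finset.univ) (f := fun j => |ξ j|)
    (fun j _ => abs_nonneg _) k
  rw [Finset.card_univ, Fintype.card_fin, div_le_iff₀' (by positivity)] at h2
  exact h2

theorem IsSymbol.one_add_norm_pow_mul_norm_symbolTransform_le (ha : IsSymbol Λ m Ω a)
    (k : ℕ) (ψ : 𝓓(Ω, ℂ)) : ∃ C : ℝ, ∀ ξ,
      (1 + ‖ξ‖) ^ (k + 1) * ‖symbolTransform a ψ ξ‖ ≤ C * m ξ := by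
  have h := fun j => ha.pow_mul_norm_symbolTransform_le j (k + 1) 0 ψ
  choose C hC using h
  obtain ⟨C₀, -, h₀⟩ :=
    ha.estimate _ ψ.hasCompactSupport.isCompact ψ.tsupport_subset 0 0
  refine ⟨2 ^ k * (C₀ * (∫ x, ‖ψ x‖) + (n : ℝ) ^ k * ∑ j, C j), fun ξ => ?_⟩
  have h1 : ‖symbolTransform a ψ ξ‖ ≤ C₀ * m ξ * ∫ x, ‖ψ x‖ :=
    norm_symbolTransform_le fun x hx => by simpa [multiPow_zero] using h₀ x hx ξ
  have h2 : ‖ξ‖ ^ (k + 1) * ‖symbolTransform a ψ ξ‖ ≤ (n : ℝ) ^ k * ∑ j, C j * m ξ := by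
    calc _ ≤ ((n : ℝ) ^ k * ∑ j, |ξ j| ^ (k + 1)) * ‖symbolTransform a ψ ξ‖ := by
          gcongr
          exact norm_pow_le_sum_abs_pow k ξ
      _ = (n : ℝ) ^ k * ∑ j, |ξ j| ^ (k + 1) * ‖symbolTransform a ψ ξ‖ := by
          rw [mul_assoc, Finset.sum_mul]
      _ ≤ _ := by
          exact mul_le_mul_of_nonneg_left (Finset.sum_le_sum fun j _ => hC j ξ) (by positivity)
  have h3 := add_pow_le zero_le_one (norm_nonneg ξ) (k + 1)
  rw [one_pow, Nat.add_sub_cancel] at h3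
  calc _ ≤ 2 ^ k * (1 + ‖ξ‖ ^ (k + 1)) * ‖symbolTransform a ψ ξ‖ := by gcongr
    _ = 2 ^ k * (‖symbolTransform a ψ ξ‖ + ‖ξ‖ ^ (k + 1) * ‖symbolTransform a ψ ξ‖) := by ring
    _ ≤ 2 ^ k * (C₀ * m ξ * (∫ x, ‖ψ x‖) + (n : ℝ) ^ k * ∑ j, C j * m ξ) := by gcongr
    _ = _ := by
      rw [← Finset.sum_mul]
      ring

theorem IsSymbol.integrable_symbolTransform (hm : IsAdmissibleWeight Λ m)
    (ha : IsSymbol Λ m Ω a) (ψ : 𝓓(Ω, ℂ)) : Integrable (symbolTransform a ψ) := by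
  obtain ⟨N, C', hN, hC', h'⟩ := hm.temperate
  -- The exponent is `⌈N⌉ + n + 1`: the part `⌈N⌉` absorbs the growth of `m`, and the remaining
  -- decay of order `n + 1` is integrable on `ℝⁿ`.
  obtain ⟨C, hC⟩ := ha.one_add_norm_pow_mul_norm_symbolTransform_le (⌈N⌉₊ + n) ψ
  have hint : Integrable (fun ξ : Rn n => (1 + ‖ξ‖) ^ (-((n + 1 : ℕ) : ℝ))) :=
    integrable_one_add_norm (by simp)
  refine (hint.const_mul (|C| * (C' * m 0))).mono'
    (aestronglyMeasurable_symbolTransform ha.continuousOn ψ)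
    (Filter.Eventually.of_forall fun ξ => ?_)
  have h1 : (1 : ℝ) ≤ 1 + ‖ξ‖ := by linarith [norm_nonneg ξ]
  have h0 : (0 : ℝ) < 1 + ‖ξ‖ := by linarith
  have h3 : (1 + ‖ξ‖) ^ N ≤ (1 + ‖ξ‖) ^ ⌈N⌉₊ := by
    rw [← Real.rpow_natCast]
    exact Real.rpow_le_rpow_of_exponent_le h1 (Nat.le_ceil N)
  have h4 : 0 ≤ C' * m 0 := (mul_pos hC' (hm.pos 0)).le
  have h5 := h' 0 ξ
  rw [sub_zero] at h5
  have h6 : (1 + ‖ξ‖) ^ ⌈N⌉₊ * ((1 + ‖ξ‖) ^ (n + 1) * ‖symbolTransform a ψ ξ‖) ≤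
      (1 + ‖ξ‖) ^ ⌈N⌉₊ * (|C| * (C' * m 0)) := by
    calc _ = (1 + ‖ξ‖) ^ (⌈N⌉₊ + n + 1) * ‖symbolTransform a ψ ξ‖ := by ring
      _ ≤ C * m ξ := hC ξ
      _ ≤ |C| * m ξ := by
        gcongr
        · exact (hm.pos ξ).le
        · exact le_abs_self C
      _ ≤ |C| * (C' * m 0 * (1 + ‖ξ‖) ^ ⌈N⌉₊) := by
        gcongr
        exact h5.trans (by gcongr)
      _ = _ := by ring
  have h7 := le_of_mul_le_mul_left h6 (by positivity)
  rw [Real.rpow_neg h0.le, Real.rpow_natCast, ← div_eq_mul_inv, le_div_iff₀' (by positivity)]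
  exact h7

/-! ### The transposed operator -/

/-- `y ↦ (2π)⁻ⁿ ∬ e^{i (x - y)·ξ} a(x, ξ) ψ(x) dx dξ`, the transpose of `a(x, D)` applied
to `ψ`. -/
def transposePdo (a : Rn n × Rn n → ℂ) (ψ : Rn n → ℂ) (y : Rn n) : ℂ :=
  ((2 * Real.pi : ℝ) ^ n : ℂ)⁻¹ *
    ∫ ξ, Complex.exp (-(Complex.I * (⟪y, ξ⟫ : ℝ))) * symbolTransform a ψ ξ

theorem norm_exp_neg_inner (x ξ : Rn n) :
    ‖Complex.exp (-(Complex.I * (⟪x, ξ⟫ : ℝ)))‖ = 1 := by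
  rw [Complex.exp_neg, norm_inv, norm_exp_inner, inv_one]

theorem IsSymbol.continuous_transposePdo (hm : IsAdmissibleWeight Λ m)
    (ha : IsSymbol Λ m Ω a) (ψ : 𝓓(Ω, ℂ)) : Continuous (transposePdo a ψ) := by
  have hb := ha.integrable_symbolTransform hm ψ
  refine continuous_const.mul (continuous_of_dominated
    (bound := fun ξ => ‖symbolTransform a ψ ξ‖) (fun y => ?_) (fun y => ?_) hb.norm ?_)
  · exact AEStronglyMeasurable.mul (by fun_prop : Continuous fun ξ : Rn n =>
      Complex.exp (-(Complex.I * (⟪y, ξ⟫ : ℝ)))).aestronglyMeasurable hb.aestronglyMeasurable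
  · exact Filter.Eventually.of_forall fun ξ => by rw [norm_mul, norm_exp_neg_inner, one_mul]
  · exact Filter.Eventually.of_forall fun ξ => by fun_prop

/-- Fubini in `(x, ξ)`: the polynomial growth of the symbol is beaten by the Schwartz decay of
`fourierHat φ`. -/
theorem integral_mul_pdo_eq_symbolTransform (hm : IsAdmissibleWeight Λ m)
    (ha : IsSymbol Λ m Ω a) (ψ φ : 𝓓(Ω, ℂ)) :
    ∫ x, ψ x * pdo a φ x = ((2 * Real.pi : ℝ) ^ n : ℂ)⁻¹ *
      ∫ ξ, symbolTransform a ψ ξ * fourierHat φ ξ := by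
  obtain ⟨g, hg⟩ := exists_schwartz_fourierHat φ
  obtain ⟨C, N, hC⟩ := ha.exists_bound hm ψ.hasCompactSupport ψ.tsupport_subset
  have hψ : Integrable ψ := ψ.continuous.integrable_of_hasCompactSupport ψ.hasCompactSupport
  have hint : Integrable (Function.uncurry fun x ξ : Rn n =>
      Complex.exp (Complex.I * (⟪x, ξ⟫ : ℝ)) * (a (x, ξ) * ψ x) * fourierHat φ ξ)
      (volume.prod volume) := by
    refine (hψ.norm.mul_prod (schwartz_integrable g C N)).mono' ?_
      (Filter.Eventually.of_forall fun z => ?_)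
    · simp only [hg]
      exact ((continuous_symbolTransform_integrand ha.continuousOn ψ).mul
        (g.continuous.comp continuous_snd)).aestronglyMeasurable
    · obtain ⟨x, ξ⟩ := z
      simp only [Function.uncurry_apply_pair, norm_mul, norm_exp_inner, one_mul, hg]
      by_cases hx : x ∈ tsupport ψ
      · rw [mul_comm ‖a (x, ξ)‖, mul_assoc]
        gcongr
        exact hC x hx ξ
      · simp [image_eq_zero_of_notMem_tsupport hx]
  calc ∫ x, ψ x * pdo a φ x
      = ∫ x, ((2 * Real.pi : ℝ) ^ n : ℂ)⁻¹ * ∫ ξ,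
          Complex.exp (Complex.I * (⟪x, ξ⟫ : ℝ)) * (a (x, ξ) * ψ x) * fourierHat φ ξ := by
        congr 1
        ext x
        rw [pdo, mul_left_comm, ← integral_const_mul]
        congr 2
        ext ξ
        ring
    _ = ((2 * Real.pi : ℝ) ^ n : ℂ)⁻¹ * ∫ ξ, ∫ x,
          Complex.exp (Complex.I * (⟪x, ξ⟫ : ℝ)) * (a (x, ξ) * ψ x) * fourierHat φ ξ := by
        rw [integral_const_mul, integral_integral_swap hint]
    _ = _ := by
        simp only [integral_mul_const, symbolTransform]

/-- A second Fubini, now in `(ξ, y)`, relies on integrability of `symbolTransform a ψ`. The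
interchanges are done in two stages because the triple integral in `(x, y, ξ)` need not converge
absolutely. -/
theorem integral_mul_pdo_eq (hm : IsAdmissibleWeight Λ m)
    (ha : IsSymbol Λ m Ω a) (ψ φ : 𝓓(Ω, ℂ)) :
    ∫ x, ψ x * pdo a φ x = ∫ y, φ y * transposePdo a ψ y := by
  have hb := ha.integrable_symbolTransform hm ψ
  have hφ : Integrable φ := φ.continuous.integrable_of_hasCompactSupport φ.hasCompactSupport
  have hint : Integrable (Function.uncurry fun ξ y : Rn n =>
      symbolTransform a ψ ξ * (Complex.exp (-(Complex.I * (⟪y, ξ⟫ : ℝ))) * φ y))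
      (volume.prod volume) := by
    refine (hb.mul_prod hφ).norm.mono' ?_ (Filter.Eventually.of_forall fun z => ?_)
    · have h1 : AEStronglyMeasurable (fun z : Rn n × Rn n => symbolTransform a ψ z.1)
          (volume.prod volume) := hb.aestronglyMeasurable.comp_fst
      have h2 : Continuous fun z : Rn n × Rn n =>
          Complex.exp (-(Complex.I * (⟪z.2, z.1⟫ : ℝ))) * φ z.2 := by
        have := φ.continuous
        fun_prop
      exact h1.mul h2.aestronglyMeasurable
    · simp only [Function.uncurry, norm_mul, norm_exp_neg_inner, one_mul, le_refl]
  calc ∫ x, ψ x * pdo a φ x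
      = ((2 * Real.pi : ℝ) ^ n : ℂ)⁻¹ * ∫ ξ, ∫ y,
          symbolTransform a ψ ξ * (Complex.exp (-(Complex.I * (⟪y, ξ⟫ : ℝ))) * φ y) := by
        rw [integral_mul_pdo_eq_symbolTransform hm ha]
        simp only [fourierHat, integral_const_mul]
    _ = ((2 * Real.pi : ℝ) ^ n : ℂ)⁻¹ * ∫ y, ∫ ξ,
          symbolTransform a ψ ξ * (Complex.exp (-(Complex.I * (⟪y, ξ⟫ : ℝ))) * φ y) := by
        rw [integral_integral_swap hint]
    _ = _ := by
        rw [← integral_const_mul]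
        congr 1
        ext y
        rw [transposePdo, mul_left_comm, ← integral_const_mul (φ y)]
        congr 1
        refine integral_congr_ae (Filter.Eventually.of_forall fun ξ => ?_)
        simp only
        ring

/-! ### The support of the transpose -/

/-- A real valued test function as a complex valued one. -/
def testOfReal (g : Rn n → ℝ) (hg : ContDiff ℝ ∞ g) (hc : HasCompactSupport g)
    (hs : tsupport g ⊆ Ω) : 𝓓(Ω, ℂ) where
  toFun x := (g x : ℂ)
  contDiff' := Complex.ofRealCLM.contDiff.comp hg
  hasCompactSupport' := hc.comp_left (g := fun t : ℝ => (t : ℂ)) Complex.ofReal_zero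
  tsupport_subset' := (closure_mono (Function.support_comp_subset Complex.ofReal_zero g)).trans hs

theorem tsupport_testOfReal_subset (g : Rn n → ℝ) (hg : ContDiff ℝ ∞ g)
    (hc : HasCompactSupport g) (hs : tsupport g ⊆ Ω) :
    tsupport (testOfReal g hg hc hs) ⊆ tsupport g :=
  closure_mono (Function.support_comp_subset Complex.ofReal_zero g)

theorem ae_eq_zero_of_integral_test_mul_eq_zero {V : Set (Rn n)} (hV : IsOpen V)
    (hVΩ : V ⊆ Ω) {f : Rn n → ℂ} (hf : LocallyIntegrableOn f V)
    (h : ∀ φ : 𝓓(Ω, ℂ), tsupport φ ⊆ V → ∫ x, φ x * f x = 0) :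
    ∀ᵐ x, x ∈ V → f x = 0 := by
  refine hV.ae_eq_zero_of_integral_contDiff_smul_eq_zero hf fun g hg hc hs => ?_
  exact h (testOfReal g hg hc (hs.trans hVΩ)) ((tsupport_testOfReal_subset g hg hc _).trans hs)

theorem eqOn_zero_of_integral_test_mul_eq_zero {V : Set (Rn n)} (hV : IsOpen V)
    (hVΩ : V ⊆ Ω) {f : Rn n → ℂ} (hf : ContinuousOn f V)
    (h : ∀ φ : 𝓓(Ω, ℂ), tsupport φ ⊆ V → ∫ x, φ x * f x = 0) : Set.EqOn f 0 V :=
  Measure.eqOn_open_of_ae_eq (μ := volume)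
    ((ae_restrict_iff' hV.measurableSet).2 (ae_eq_zero_of_integral_test_mul_eq_zero hV hVΩ
      (hf.locallyIntegrableOn hV.measurableSet) h)) hV hf continuousOn_const

theorem tsupport_tensor_subset (ψ φ : Rn n → ℂ) :
    tsupport (fun z : Rn n × Rn n => ψ z.1 * φ z.2) ⊆ tsupport ψ ×ˢ tsupport φ := by
  refine closure_minimal (fun z hz => ?_) ((isClosed_tsupport ψ).prod (isClosed_tsupport φ))
  exact ⟨subset_tsupport _ (left_ne_zero_of_mul hz), subset_tsupport _ (right_ne_zero_of_mul hz)⟩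

/-- The test function `(x, y) ↦ ψ(x) φ(y)`. -/
def testTensor (ψ φ : 𝓓(Ω, ℂ)) : 𝓓(square Ω, ℂ) where
  toFun z := ψ z.1 * φ z.2
  contDiff' := (ψ.contDiff.comp contDiff_fst).mul (φ.contDiff.comp contDiff_snd)
  hasCompactSupport' :=
    (ψ.hasCompactSupport.isCompact.prod φ.hasCompactSupport.isCompact).of_isClosed_subset
      (isClosed_tsupport _) (tsupport_tensor_subset ψ φ)
  tsupport_subset' := (tsupport_tensor_subset ψ φ).trans
    (Set.prod_mono ψ.tsupport_subset φ.tsupport_subset)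

theorem kernel_testTensor (ψ φ : 𝓓(Ω, ℂ)) :
    kernel Ω a (testTensor ψ φ) = ∫ x, ψ x * pdo a φ x := by
  have h : ∀ x, pdo a (fun y => testTensor ψ φ (x, y)) x = ψ x * pdo a φ x :=
    fun x => pdo_smul (ψ x) φ x
  simp only [kernel, h]
  refine setIntegral_eq_integral_of_forall_compl_eq_zero fun x hx => ?_
  rw [image_eq_zero_of_notMem_tsupport fun h => hx (ψ.tsupport_subset h), zero_mul]

/-- The kernel vanishes on a product neighbourhood of `(x, y)`. Testing it on tensor products makes
`a(x, D)φ` vanish weakly near `x`, hence pointwise by continuity. The neighbourhoods do not depend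
on `φ`. -/
theorem pdo_eq_zero_of_notMem_kernelSupport (hm : IsAdmissibleWeight Λ m)
    (ha : IsSymbol Λ m Ω a) {x y : Rn n} (hx : x ∈ Ω) (hy : y ∈ Ω)
    (hxy : (x, y) ∉ kernelSupport Ω a) :
    ∃ U ∈ nhds x, ∃ V : Set (Rn n), IsOpen V ∧ y ∈ V ∧ V ⊆ Ω ∧
      ∀ φ : 𝓓(Ω, ℂ), tsupport φ ⊆ V → ∀ x' ∈ U, pdo a φ x' = 0 := by
  have h1 : (x, y) ∉ Distribution.dsupport (kernel Ω a) := fun h => hxy ⟨h, hx, hy⟩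
  obtain ⟨s, hs, hso, hxs⟩ := (Distribution.notMem_dsupport_iff _).1 h1
  obtain ⟨U, V, hU, hV, hxU, hyV, hUV⟩ := isOpen_prod_iff.1 hso x y hxs
  have hUΩ := hU.inter Ω.isOpen
  refine ⟨U ∩ Ω, hUΩ.mem_nhds ⟨hxU, hx⟩, V ∩ Ω, hV.inter Ω.isOpen, ⟨hyV, hy⟩,
    Set.inter_subset_right, fun φ hφ => ?_⟩
  refine eqOn_zero_of_integral_test_mul_eq_zero hUΩ Set.inter_subset_right
    ((pdo_continuousOn hm ha φ).mono Set.inter_subset_right) fun ψ hψ => ?_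
  rw [← kernel_testTensor]
  refine hs _ ((tsupport_tensor_subset ψ φ).trans (.trans ?_ hUV))
  exact Set.prod_mono (hψ.trans Set.inter_subset_left) (hφ.trans Set.inter_subset_left)

theorem transposePdo_eq_zero (hm : IsAdmissibleWeight Λ m) (ha : IsSymbol Λ m Ω a)
    (ψ : 𝓓(Ω, ℂ)) {y : Rn n} (hy : y ∈ Ω)
    (h : ∀ x ∈ tsupport ψ, (x, y) ∉ kernelSupport Ω a) : transposePdo a ψ y = 0 := by
  -- A tube-lemma argument: compactness of `tsupport ψ` leaves finitely many neighbourhoods of `y`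
  -- to intersect, giving one `V` valid for all `x` in the support.
  obtain ⟨V, hV, hyV, hVΩ, hzero⟩ : ∃ V : Set (Rn n), IsOpen V ∧ y ∈ V ∧ V ⊆ Ω ∧
      ∀ φ : 𝓓(Ω, ℂ), tsupport φ ⊆ V → ∀ x ∈ tsupport ψ, pdo a φ x = 0 := by
    refine ψ.hasCompactSupport.isCompact.induction_on
      (p := fun s => ∃ V : Set (Rn n), IsOpen V ∧ y ∈ V ∧ V ⊆ Ω ∧
        ∀ φ : 𝓓(Ω, ℂ), tsupport φ ⊆ V → ∀ x ∈ s, pdo a φ x = 0) ?_ ?_ ?_ ?_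
    · exact ⟨Ω, Ω.isOpen, hy, le_rfl, by simp⟩
    · rintro s t hst ⟨V, hV, hyV, hVΩ, h⟩
      exact ⟨V, hV, hyV, hVΩ, fun φ hφ x hx => h φ hφ x (hst hx)⟩
    · rintro s t ⟨V, hV, hyV, hVΩ, h⟩ ⟨W, hW, hyW, -, h'⟩
      refine ⟨V ∩ W, hV.inter hW, ⟨hyV, hyW⟩, Set.inter_subset_left.trans hVΩ,
        fun φ hφ x hx => ?_⟩
      exact hx.elim (h φ (hφ.trans Set.inter_subset_left) x)
        (h' φ (hφ.trans Set.inter_subset_right) x)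
    · intro x hx
      obtain ⟨U, hU, hV⟩ := pdo_eq_zero_of_notMem_kernelSupport hm ha (ψ.tsupport_subset hx) hy
        (h x hx)
      exact ⟨U, mem_nhdsWithin_of_mem_nhds hU, hV⟩
  refine eqOn_zero_of_integral_test_mul_eq_zero hV hVΩ
    (ha.continuous_transposePdo hm ψ).continuousOn (fun φ hφ => ?_) hyV
  -- By duality, `transposePdo a ψ` tested against `φ` supported in `V` is the integral of `ψ · a(x,
  -- D)φ`, whose integrand vanishes identically.
  rw [← integral_mul_pdo_eq hm ha, ← integral_zero (Rn n) ℂ]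
  congr 1
  ext x
  by_cases hx : x ∈ tsupport ψ
  · rw [hzero φ hφ x hx, mul_zero]
  · rw [image_eq_zero_of_notMem_tsupport hx, zero_mul]

/-- Restricting to this projection lets the right side make sense for any element of `L^p_loc(Ω)` in
place of `φ`, once the projection is compact. -/
theorem integral_mul_pdo_eq_setIntegral (hm : IsAdmissibleWeight Λ m) (ha : IsSymbol Λ m Ω a)
    (ψ φ : 𝓓(Ω, ℂ)) :
    ∫ x, ψ x * pdo a φ x = ∫ y in Prod.snd '' (kernelSupport Ω a ∩ Prod.fst ⁻¹' tsupport ψ),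
      transposePdo a ψ y * φ y := by
  rw [integral_mul_pdo_eq hm ha, setIntegral_eq_integral_of_forall_compl_eq_zero]
  · simp only [mul_comm]
  · intro y hy
    by_cases hyΩ : y ∈ Ω
    · rw [transposePdo_eq_zero hm ha ψ hyΩ, zero_mul]
      exact fun x hx hxy => hy ⟨(x, y), ⟨hxy, hx⟩, rfl⟩
    · rw [image_eq_zero_of_notMem_tsupport fun h => hyΩ (φ.tsupport_subset h), mul_zero]

/-! ### Functionals on `L^p_loc(Ω)` -/

theorem LpLoc.integrableOn {p : ℝ≥0∞} [Fact (1 ≤ p)] (f : LpLoc Ω p) {K : Set (Rn n)}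
    (hK : IsCompact K) (hKΩ : K ⊆ Ω) : IntegrableOn f.1 K := by
  have : IsFiniteMeasure (volume.restrict K) := ⟨by simpa using hK.measure_lt_top⟩
  exact (f.2 K hK hKΩ).integrable Fact.out

theorem LpLoc.integrableOn_mul {p : ℝ≥0∞} [Fact (1 ≤ p)] (f : LpLoc Ω p) {K : Set (Rn n)}
    (hK : IsCompact K) (hKΩ : K ⊆ Ω) {w : Rn n → ℂ} (hw : Continuous w) :
    IntegrableOn (fun x => w x * f.1 x) K :=
  (f.integrableOn hK hKΩ).continuousOn_mul hw.continuousOn hK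

/-- The functional `f ↦ ∫_K w f` on `L^p_loc(Ω)`. -/
def LpLoc.setIntegralMul (p : ℝ≥0∞) [Fact (1 ≤ p)] {K : Set (Rn n)}
    (hK : IsCompact K) (hKΩ : K ⊆ Ω) {w : Rn n → ℂ} (hw : Continuous w) :
    LpLoc Ω p →ₗ[ℂ] ℂ where
  toFun f := ∫ x in K, w x * f.1 x
  map_add' f g := by
    rw [← integral_add (f.integrableOn_mul hK hKΩ hw) (g.integrableOn_mul hK hKΩ hw)]
    refine integral_congr_ae ?_
    filter_upwards [ae_mono (Measure.restrict_mono hKΩ le_rfl) (AEEqFun.coeFn_add f.1 g.1)]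
      with x hx
    rw [← mul_add]
    exact congrArg (w x * ·) hx
  map_smul' c f := by
    rw [RingHom.id_apply, smul_eq_mul, ← integral_const_mul]
    refine integral_congr_ae ?_
    filter_upwards [ae_mono (Measure.restrict_mono hKΩ le_rfl) (AEEqFun.coeFn_smul c f.1)]
      with x hx
    rw [mul_left_comm]
    exact congrArg (w x * ·) hx

theorem LpLoc.continuous_setIntegralMul (p : ℝ≥0∞) [Fact (1 ≤ p)] {K : Set (Rn n)}
    (hK : IsCompact K) (hKΩ : K ⊆ Ω) {w : Rn n → ℂ} (hw : Continuous w) :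
    Continuous (setIntegralMul (Ω := Ω) p hK hKΩ hw) := by
  have : IsFiniteMeasure (volume.restrict K) := ⟨by simpa using hK.measure_lt_top⟩
  obtain ⟨B, hB⟩ := hK.exists_bound_of_continuousOn hw.continuousOn
  -- The Hölder constant `|K|^(1 - 1/p)` comparing the `L¹(K)` and `L^p(K)` norms; a single
  -- seminorm, that of `K`, then controls the functional.
  set c : ℝ≥0∞ := volume.restrict K Set.univ ^ (1 / (1 : ℝ≥0∞).toReal - 1 / p.toReal) with hc
  have hexp : 0 ≤ 1 / (1 : ℝ≥0∞).toReal - 1 / p.toReal := by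
    rcases eq_or_ne p ⊤ with rfl | hp
    · simp
    · have h1 : 1 ≤ p.toReal := by
        simpa using ENNReal.toReal_mono hp (Fact.out : 1 ≤ p)
      rw [ENNReal.toReal_one, div_one, sub_nonneg]
      exact div_le_one_of_le₀ h1 (by positivity)
  have hctop : c ≠ ⊤ := ENNReal.rpow_ne_top_of_nonneg hexp (measure_ne_top _ _)
  let K' : CompactsIn Ω := ⟨⟨K, hK⟩, hKΩ⟩
  refine WithSeminorms.continuous_normedSpace_rng ℂ (LpLoc.withSeminorms Ω p) _
    ⟨{K'}, ⟨|B| * c.toReal, by positivity⟩, fun f => ?_⟩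
  have hf := f.2 K hK hKΩ
  have hle := eLpNorm_le_eLpNorm_mul_rpow_measure_univ (Fact.out : 1 ≤ p) hf.1
  rw [Finset.sup_singleton]
  change ‖∫ x in K, w x * f.1 x‖ ≤
    (|B| * c.toReal) * (eLpNorm (f.1 : Rn n → ℂ) p (volume.restrict K)).toReal
  calc ‖∫ x in K, w x * f.1 x‖ ≤ ∫ x in K, |B| * ‖f.1 x‖ := by
        refine norm_integral_le_of_norm_le ((f.integrableOn hK hKΩ).norm.const_mul _)
          ((ae_restrict_iff' hK.measurableSet).2 (Filter.Eventually.of_forall fun x hx => ?_))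
        rw [norm_mul]
        gcongr
        exact (hB x hx).trans (le_abs_self B)
    _ = |B| * (eLpNorm (f.1 : Rn n → ℂ) 1 (volume.restrict K)).toReal := by
        rw [integral_const_mul, integral_norm_eq_lintegral_enorm hf.1,
          eLpNorm_one_eq_lintegral_enorm]
    _ ≤ |B| * (eLpNorm (f.1 : Rn n → ℂ) p (volume.restrict K) * c).toReal := by
        gcongr
        exact ENNReal.mul_ne_top hf.2.ne hctop
    _ = _ := by
        rw [ENNReal.toReal_mul]
        ring

theorem LpLoc.eq_zero_of_setIntegral_test_mul_eq_zero {p : ℝ≥0∞} [Fact (1 ≤ p)] (f : LpLoc Ω p)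
    (h : ∀ ψ : 𝓓(Ω, ℂ), ∫ x in tsupport ψ, ψ x * f.1 x = 0) : f = 0 := by
  refine LpLoc.ext_ae (.trans ?_ AEEqFun.coeFn_zero.symm)
  refine (ae_restrict_iff' Ω.isOpen.measurableSet).2 ?_
  refine ae_eq_zero_of_integral_test_mul_eq_zero Ω.isOpen le_rfl ?_ fun ψ _ => ?_
  · exact (locallyIntegrableOn_iff Ω.isOpen.isLocallyClosed).2
      fun K hKΩ hK => f.integrableOn hK hKΩ
  · rw [← h ψ, setIntegral_eq_integral_of_forall_compl_eq_zero]
    intro x hx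
    rw [image_eq_zero_of_notMem_tsupport hx, zero_mul]

theorem setIntegral_mul_ofContinuousOn {p : ℝ≥0∞} {g : Rn n → ℂ} (hg : ContinuousOn g Ω)
    {K : Set (Rn n)} (hKΩ : K ⊆ Ω) (w : Rn n → ℂ) :
    ∫ x in K, w x * (LpLoc.ofContinuousOn p g hg).1 x = ∫ x in K, w x * g x := by
  refine integral_congr_ae ?_
  filter_upwards [ae_mono (Measure.restrict_mono hKΩ le_rfl)
    (LpLoc.coeFn_ofContinuousOn p g hg)] with x hx
  rw [hx]

/-! ### Passage to the closure of the graph -/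

theorem mem_graph_opLpLoc {p : ℝ≥0∞} (hm : IsAdmissibleWeight Λ m) (ha : IsSymbol Λ m Ω a)
    {z : LpLoc Ω p × LpLoc Ω p} (hz : z ∈ (opLpLoc p hm ha).graph) :
    ∃ φ : 𝓓(Ω, ℂ), z = (testInclusion Ω p φ, pdoTest p hm ha φ) := by
  obtain ⟨⟨_, φ, rfl⟩, h1, h2⟩ := (LinearPMap.mem_graph_iff _).1 hz
  refine ⟨φ, Prod.ext h1.symm (h2.symm.trans ?_)⟩
  change pdoTest p hm ha ((LinearEquiv.ofInjective (testInclusion Ω p)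
    (testInclusion_injective Ω p)).symm (LinearEquiv.ofInjective (testInclusion Ω p)
      (testInclusion_injective Ω p) φ)) = _
  rw [LinearEquiv.symm_apply_apply]

theorem isClosable_opLpLoc {p : ℝ≥0∞} [Fact (1 ≤ p)] (hm : IsAdmissibleWeight Λ m)
    (ha : IsSymbol Λ m Ω a) (hprop : IsProperlySupported Ω a) :
    (opLpLoc p hm ha).IsClosable := by
  refine ⟨(opLpLoc p hm ha).graph.topologicalClosure.toLinearPMap,
    (Submodule.toLinearPMap_graph_eq _ ?_).symm⟩
  -- A subspace is the graph of an operator as soon as `(0, g)` in it forces `g = 0`.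
  rintro ⟨f, g⟩ hfg (rfl : f = 0)
  refine LpLoc.eq_zero_of_setIntegral_test_mul_eq_zero g fun ψ => ?_
  have hK := ψ.hasCompactSupport.isCompact
  have hKΩ := ψ.tsupport_subset
  -- Properness of the first projection enters here: it keeps the domain of the dual integral
  -- compact inside `Ω`.
  have hL : IsCompact (Prod.snd '' (kernelSupport Ω a ∩ Prod.fst ⁻¹' tsupport ψ)) :=
    (hprop _ hK hKΩ).1.image continuous_snd
  have hLΩ : Prod.snd '' (kernelSupport Ω a ∩ Prod.fst ⁻¹' tsupport ψ) ⊆ (Ω : Set (Rn n)) := by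
    rintro _ ⟨z, ⟨hz, -⟩, rfl⟩
    exact hz.2.2
  have hw := ha.continuous_transposePdo hm ψ
  -- The duality identity defines a closed set, being an equality of two continuous functionals; it
  -- contains the graph, hence also its closure.
  have hsub : closure ((opLpLoc p hm ha).graph : Set (LpLoc Ω p × LpLoc Ω p)) ⊆
      {z | LpLoc.setIntegralMul p hK hKΩ ψ.continuous z.2 =
        LpLoc.setIntegralMul p hL hLΩ hw z.1} := by
    refine closure_minimal (fun z hz => ?_) (isClosed_eq
      ((LpLoc.continuous_setIntegralMul p hK hKΩ ψ.continuous).comp continuous_snd)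
      ((LpLoc.continuous_setIntegralMul p hL hLΩ hw).comp continuous_fst))
    obtain ⟨φ, rfl⟩ := mem_graph_opLpLoc hm ha hz
    have h1 := setIntegral_mul_ofContinuousOn (p := p) (pdo_continuousOn hm ha φ) hKΩ ψ
    have h2 := setIntegral_mul_ofContinuousOn (p := p) (φ.continuous.continuousOn (s := Ω)) hLΩ
      (transposePdo a ψ)
    refine h1.trans (.trans ?_ h2.symm)
    rw [← integral_mul_pdo_eq_setIntegral hm ha, setIntegral_eq_integral_of_forall_compl_eq_zero]
    intro x hx
    rw [image_eq_zero_of_notMem_tsupport hx, zero_mul]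
  have h := hsub hfg
  rw [Set.mem_ofPred_eq, map_zero] at h
  exact h

end MPseudo

end


/-- A properly supported `m`-pseudodifferential operator with symbol in `S_{m,Λ}(Ω)`, `m ≥ c > 0`,
considered as an operator in the Fréchet space `L^p_loc(Ω)`, `1 < p < ∞`, with
domain `C₀^∞(Ω)`, is closable. -/
theorem proposition3p2 (n : ℕ) (Ω : Opens (MPseudo.Rn n))
    (Λ : Fin n → MPseudo.Rn n → ℝ) (hΛ : MPseudo.IsWeightVector Λ)
    (m : MPseudo.Rn n → ℝ) (hm : MPseudo.IsAdmissibleWeight Λ m)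
    (hmc : ∃ c : ℝ, 0 < c ∧ ∀ ξ, c ≤ m ξ)
    (a : MPseudo.Rn n × MPseudo.Rn n → ℂ) (ha : MPseudo.IsSymbol Λ m Ω a)
    (hprop : MPseudo.IsProperlySupported Ω a)
    (p : ℝ≥0∞) [Fact (1 ≤ p)] (hp : 1 < p) (hp' : p < ⊤) :
    (MPseudo.opLpLoc p hm ha).IsClosable := by
  exact MPseudo.isClosable_opLpLoc hm ha hprop
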